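/- Let $F=\mathbb F_q$ be a finite field with $q$ elements and let $\overline F$ be an algebraic closure of $F$. An element $\alpha\in GL(n,q)=GL(n,F)$ is called semisimple if it is diagonalizable over $\overline F$; it is called regular if the dimension of its centralizer in the algebraic group $GL(n,\overline F)$ is as small as possible, that is, at most the dimension of the centralizer of any element of $GL(n,\overline F)$; and it is called regular semisimple if it is both. For a monic irreducible polynomial $\phi\in F[z]$ let $|\lambda_\phi(\alpha)|$ be the size of the partition attached to $\phi$ in the rational canonical form of $\alpha$, i.e. the exponent of $\phi$ in the characteristic polynomial $\prod_\phi \phi^{|\lambda_\phi(\alpha)|}$ of $\alpha$. Then, for every $n$, an element $\alpha\in GL(n,q)$ is regular semisimple if and only if $|\lambda_\phi(\alpha)|\le 1$ for all monic irreducible $\phi$; and, for fixed $q$, $$\lim_{n\to\infty}\frac{\#\{\alpha\in GL(n,q):\ \alpha\text{ is regular semisimple}\}}{|GL(n,q)|}=1-\frac1q .$$ -/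

import Mathlib

open Filter Topology

namespace GLRegSS

/-- The dimension of a (locally closed) subset `S` of affine space `K^σ` in the Zariski topology:
the Krull dimension of the coordinate ring of its Zariski closure. -/
noncomputable def zariskiDim {σ K : Type*} [Field K] (S : Set (σ → K)) : WithBot ℕ∞ :=
  ringKrullDim (MvPolynomial σ K ⧸ MvPolynomial.vanishingIdeal K S)

/-- `GL(n, K)` as an open subset of the affine space of all `n × n` matrices:
the point of `K^(n × n)` given by the entries of `g`. -/
def entries {n : ℕ} {K : Type*} [Field K] (g : GL (Fin n) K) : Fin n × Fin n → K :=
  fun p => (g : Matrix (Fin n) (Fin n) K) p.1 p.2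

/-- The dimension of the centralizer of `g` in the algebraic group `GL(n, K)`
(used for `K` algebraically closed). -/
noncomputable def centralizerDim {n : ℕ} {K : Type*} [Field K] (g : GL (Fin n) K) :
    WithBot ℕ∞ :=
  zariskiDim (entries '' (Subgroup.centralizer {g} : Set (GL (Fin n) K)))

/-- An element of `GL(n, F)`, regarded in `GL(n, F̄)`. -/
noncomputable def toClosure {n : ℕ} {F : Type*} [Field F] (α : GL (Fin n) F) :
    GL (Fin n) (AlgebraicClosure F) :=
  Matrix.GeneralLinearGroup.map (algebraMap F (AlgebraicClosure F)) α

/-- `α` is semisimple: diagonalizable over the algebraic closure. -/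
def IsSemisimple {n : ℕ} {F : Type*} [Field F] (α : GL (Fin n) F) : Prop :=
  ∃ P : GL (Fin n) (AlgebraicClosure F),
    ((P * toClosure α * P⁻¹ : GL (Fin n) (AlgebraicClosure F)) :
      Matrix (Fin n) (Fin n) (AlgebraicClosure F)).IsDiag

/-- `α` is regular: its centralizer in the algebraic group `GL(n, F̄)` has the smallest
dimension among all centralizers of elements of `GL(n, F̄)`. -/
def IsRegular {n : ℕ} {F : Type*} [Field F] (α : GL (Fin n) F) : Prop :=
  ∀ g : GL (Fin n) (AlgebraicClosure F), centralizerDim (toClosure α) ≤ centralizerDim g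

/-- `α` is regular semisimple. -/
def IsRegularSemisimple {n : ℕ} {F : Type*} [Field F] (α : GL (Fin n) F) : Prop :=
  IsRegular α ∧ IsSemisimple α

/-- The size `|λ_φ(α)|` of the partition attached to the monic irreducible polynomial `φ` in the
rational canonical form of `α`. The characteristic polynomial of `α` is `∏_φ φ ^ |λ_φ(α)|`, so
this is the exponent of `φ` in it. -/
noncomputable def partitionSize {n : ℕ} {F : Type*} [Field F] (α : GL (Fin n) F)
    (φ : Polynomial F) : ℕ∞ :=
  emultiplicity φ (α : Matrix (Fin n) (Fin n) F).charpoly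

/-- The probability that a uniformly distributed element of `GL(n, F)` is regular semisimple. -/
noncomputable def probRegularSemisimple (F : Type*) [Field F] (n : ℕ) : ℝ :=
  (Nat.card {α : GL (Fin n) F // IsRegularSemisimple α} : ℝ) / (Nat.card (GL (Fin n) F) : ℝ)

end GLRegSS

/-!
For a field `K` that is algebraically closed, or merely infinite, the centralizer of `g` in
`GL(n, K)` is a nonempty Zariski open part of the linear space of all matrices commuting with `g`,
so its dimension is the linear dimension of that space (`centralizerDim_eq_finrank`). The structure
theorem for modules over `K[X]` shows that it is always at least `n`
(`card_le_finrank_centralizer`), and for a diagonal matrix it equals `n` exactly when the diagonal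
entries are distinct. A matrix with squarefree characteristic polynomial `f` has a cyclic vector
(`exists_cyclic_vector`), that is, it acts like multiplication by `X` on `K[X]/(f)`, so any two of
them with the same `f` are conjugate. As `F` is perfect, `α` is therefore regular semisimple if and
only if its characteristic polynomial is squarefree.

For a squarefree product `f` of monic irreducible polynomials `φ ≠ X`, the isomorphisms
`F[X]/(f) ≃ Fⁿ` form a torsor under `GL(n, F)` and map onto the matrices with characteristic
polynomial `f`, with fibres that are torsors under the units of `F[X]/(f)`. So the proportion of
such matrices in `GL(n, F)` is the product of the numbers `1 / (q ^ deg φ - 1)`, and with `aₙ` the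
proportion of regular semisimple elements, `∑ aₙ uⁿ = ∏ (1 + u ^ deg φ / (q ^ deg φ - 1))`, the
product being over all monic irreducible `φ ≠ X`.

Multiplying by the Euler product `1 - u = ∏ (1 - (u / q) ^ deg φ)` over all `φ`
(`tprod_one_sub_pow_natDegree`), one obtains a product whose factor at `φ ≠ X` is
`1 + u ^ d * (1 - u ^ d) / (q ^ d * (q ^ d - 1))` with `d = deg φ`, while the factor at `X` is
`1 - u / q`. This product converges for `|u| ^ 2 < q`, hence is holomorphic on a disc of radius
greater than one, and at `u = 1` its value is `1 - 1 / q`. Thus `aₙ`, a partial sum of the Taylor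
coefficients of this function, tends to `1 - 1 / q` (`tendsto_coeff_of_hasSum_div_one_sub`).
-/

namespace GLRegSS

/-! ### The dimension of a centralizer -/

open MvPolynomial in
/-- A nonempty open part of a linear subspace `V` of affine space over an infinite field has the
dimension of `V`: its coordinate ring is the polynomial ring in the coordinates of `V` with respect
to a basis. -/
theorem zariskiDim_eq_finrank {σ K : Type*} [Finite σ] [Field K] [Infinite K]
    (V : Submodule K (σ → K)) (S : Set (σ → K)) (hSV : S ⊆ V) (f : MvPolynomial σ K)
    (hf : ∃ v ∈ V, eval v f ≠ 0) (hS : ∀ v ∈ V, eval v f ≠ 0 → v ∈ S) :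
    zariskiDim S = (Module.finrank K V : WithBot ℕ∞) := by
  classical
  have := Fintype.ofFinite σ
  let d := Module.finrank K V
  let b : Module.Basis (Fin d) K V := Module.finBasis K V
  -- the substitution of the parametrization `t ↦ ∑ tᵢ bᵢ` of `V`
  let φ : MvPolynomial σ K →ₐ[K] MvPolynomial (Fin d) K :=
    aeval fun s => ∑ i, C ((b i : σ → K) s) * X i
  have hφ : ∀ (p : MvPolynomial σ K) (t : Fin d → K),
      eval t (φ p) = eval ((∑ i, t i • b i : V) : σ → K) p := by
    intro p t
    have : (aeval t : MvPolynomial (Fin d) K →ₐ[K] K).comp φ =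
        aeval ((∑ i, t i • b i : V) : σ → K) := by
      apply MvPolynomial.algHom_ext
      intro s
      simp [φ, mul_comm]
    simpa [coe_aeval_eq_eval] using congrArg (fun g => g p) this
  have hpar : ∀ v ∈ V, ∃ t : Fin d → K, ((∑ i, t i • b i : V) : σ → K) = v := by
    intro v hv
    exact ⟨b.repr ⟨v, hv⟩, by rw [b.sum_repr]⟩
  have hφf : φ f ≠ 0 := by
    obtain ⟨v, hv, hne⟩ := hf
    obtain ⟨t, rfl⟩ := hpar v hv
    rw [← hφ] at hne
    rintro h
    simp [h] at hne
  have hker : RingHom.ker φ = vanishingIdeal K S := by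
    ext p
    rw [RingHom.mem_ker, mem_vanishingIdeal_iff]
    constructor
    · intro h v hv
      obtain ⟨t, rfl⟩ := hpar v (hSV hv)
      change eval _ p = 0
      rw [← hφ, h, map_zero]
    · intro h
      -- `p * f` vanishes on all of `V`, and the polynomial ring is a domain
      have : φ (p * f) = 0 := by
        apply MvPolynomial.funext
        intro t
        rw [hφ, map_mul, map_zero]
        by_cases h0 : eval ((∑ i, t i • b i : V) : σ → K) f = 0
        · rw [h0, mul_zero]
        · have : eval _ p = 0 := h _ (hS _ (Submodule.coe_mem _) h0)
          rw [this, zero_mul]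
      rw [map_mul] at this
      exact (mul_eq_zero.1 this).resolve_right hφf
  have hsurj : Function.Surjective φ := by
    -- a linear left inverse of the parametrization gives a preimage of each coordinate
    obtain ⟨L, hL⟩ := (V.subtype ∘ₗ b.equivFun.symm.toLinearMap).exists_leftInverse_of_injective
      (by
        rw [LinearMap.ker_eq_bot]
        exact V.injective_subtype.comp b.equivFun.symm.injective)
    rw [← AlgHom.range_eq_top, eq_top_iff, ← MvPolynomial.adjoin_range_X, Algebra.adjoin_le_iff]
    rintro _ ⟨j, rfl⟩
    refine ⟨∑ s, C (L (Pi.single s 1) j) * X s, ?_⟩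
    apply MvPolynomial.funext
    intro t
    have h1 : ∀ v : σ → K, L v j = ∑ s, L (Pi.single s 1) j * v s := by
      intro v
      conv_lhs => rw [pi_eq_sum_univ' v]
      simp [Finset.sum_apply, mul_comm]
    have h2 := congrFun (LinearMap.congr_fun hL t) j
    simp only [LinearMap.comp_apply, LinearMap.id_apply] at h2
    rw [h1] at h2
    rw [AlgHom.toRingHom_eq_coe, RingHom.coe_coe, hφ, eval_X, map_sum, ← h2]
    refine Finset.sum_congr rfl fun s _ => ?_
    simp
  unfold zariskiDim
  rw [← hker, ringKrullDim_eq_of_ringEquiv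
    (Ideal.quotientKerAlgEquivOfSurjective hsurj).toRingEquiv,
    MvPolynomial.ringKrullDim_of_isNoetherianRing, ringKrullDim_eq_zero_of_field]
  simp [d]

theorem centralizerDim_eq_finrank {n : ℕ} {K : Type*} [Field K] [Infinite K]
    (g : GL (Fin n) K) :
    centralizerDim g =
      (Module.finrank K (Subalgebra.centralizer K {(g : Matrix (Fin n) (Fin n) K)}) :
        WithBot ℕ∞) := by
  let E : Matrix (Fin n) (Fin n) K ≃ₗ[K] (Fin n × Fin n → K) :=
    (LinearEquiv.curry K K (Fin n) (Fin n)).symm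
  let W := Subalgebra.toSubmodule (Subalgebra.centralizer K {(g : Matrix (Fin n) (Fin n) K)})
  have hE : ∀ A : Matrix (Fin n) (Fin n) K,
      MvPolynomial.eval (E A) (Matrix.mvPolynomialX (Fin n) (Fin n) K).det = A.det := by
    intro A
    rw [RingHom.map_det]
    congr 1
    ext i j
    rw [RingHom.mapMatrix_apply, Matrix.map_apply, Matrix.mvPolynomialX_apply, MvPolynomial.eval_X]
    rfl
  have key := zariskiDim_eq_finrank (W.map E.toLinearMap)
    (entries '' (Subgroup.centralizer {g} : Set (GL (Fin n) K))) ?_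
    (Matrix.mvPolynomialX (Fin n) (Fin n) K).det ?_ ?_
  · unfold centralizerDim
    rw [key, LinearEquiv.finrank_map_eq]
    rfl
  · rintro _ ⟨h, hh, rfl⟩
    refine ⟨h.1, ?_, rfl⟩
    have := congrArg Units.val (Subgroup.mem_centralizer_singleton_iff.1 hh)
    exact (Subalgebra.mem_centralizer_iff K).2 (by simpa using this.symm)
  · refine ⟨E 1, ⟨1, one_mem (Subalgebra.centralizer K {(g : Matrix (Fin n) (Fin n) K)}), rfl⟩, ?_⟩
    rw [hE]
    simp
  · rintro _ ⟨A, hA, rfl⟩ h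
    have h' : A.det ≠ 0 := by rw [← hE]; exact h
    refine ⟨Matrix.GeneralLinearGroup.mkOfDetNeZero A h', ?_, rfl⟩
    have hA' : (g : Matrix (Fin n) (Fin n) K) * A = A * g := by
      simpa using (Subalgebra.mem_centralizer_iff K).1 hA
    refine Subgroup.mem_centralizer_singleton_iff.2 (Units.ext ?_)
    exact hA'.symm

/-! ### Commuting matrices and cyclic vectors -/

section Linear

open Polynomial Matrix

variable {F ι : Type*} [Field F] [Fintype ι] [DecidableEq ι]

theorem aeval_mulVec_of_mulVec_eq_smul {M : Matrix ι ι F} {v : ι → F} {μ : F}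
    (h : M *ᵥ v = μ • v) (p : F[X]) : aeval M p *ᵥ v = p.eval μ • v := by
  induction p using Polynomial.induction_on' with
  | add p q hp hq => rw [map_add, add_mulVec, hp, hq, eval_add, add_smul]
  | monomial k c =>
    have hk : M ^ k *ᵥ v = μ ^ k • v := by
      induction k with
      | zero => simp
      | succ k ih => rw [pow_succ, ← mulVec_mulVec, h, mulVec_smul, ih, smul_smul, pow_succ']
    rw [aeval_monomial, ← Algebra.smul_def, smul_mulVec, hk, smul_smul, eval_monomial]

/-- Over the field `F[X]/(φ)` the class of `X` is an eigenvalue of `M`, so `φ(M)` is singular. -/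
theorem exists_aeval_mulVec_eq_zero {M : Matrix ι ι F} {φ : F[X]} (hφ : Irreducible φ)
    (hdvd : φ ∣ M.charpoly) : ∃ v ≠ 0, aeval M φ *ᵥ v = 0 := by
  have := Fact.mk hφ
  rw [Matrix.exists_mulVec_eq_zero_iff]
  let L := AdjoinRoot φ
  let ρ : Matrix ι ι F →ₐ[F] Matrix ι ι L := (Algebra.ofId F L).mapMatrix
  have hρ : ρ M = M.map (algebraMap F L) := rfl
  have hroot : (ρ M).charpoly.eval (AdjoinRoot.root φ) = 0 := by
    rw [hρ, Matrix.charpoly_map, eval_map_algebraMap, AdjoinRoot.aeval_eq, AdjoinRoot.mk_eq_zero]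
    exact hdvd
  rw [Matrix.eval_charpoly, ← Matrix.exists_mulVec_eq_zero_iff] at hroot
  obtain ⟨w, hw, h⟩ := hroot
  have h' : ρ M *ᵥ w = AdjoinRoot.root φ • w := by
    rw [sub_mulVec, sub_eq_zero] at h
    rw [← h]
    ext i
    simp [Matrix.scalar_apply, mulVec_diagonal]
  have h2 := aeval_mulVec_of_mulVec_eq_smul h' (φ.map (algebraMap F L))
  rw [aeval_map_algebraMap, eval_map_algebraMap, AdjoinRoot.aeval_eq, AdjoinRoot.mk_self, zero_smul,
    Polynomial.aeval_algHom_apply] at h2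
  have h3 : (ρ (aeval M φ)).det = 0 := Matrix.exists_mulVec_eq_zero_iff.1 ⟨w, hw, h2⟩
  have h4 : algebraMap F L (aeval M φ).det = 0 := by
    rw [RingHom.map_det]
    exact h3
  exact (map_eq_zero _).1 h4

/-- A matrix with squarefree characteristic polynomial has a cyclic vector: the sum of one nonzero
vector from the kernel of `φ(M)` for each irreducible factor `φ`. -/
theorem exists_cyclic_vector {M : Matrix ι ι F} (h : Squarefree M.charpoly) :
    ∃ v : ι → F, ∀ p : F[X], aeval M p *ᵥ v = 0 → M.charpoly ∣ p := by
  classical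
  have hM0 : M.charpoly ≠ 0 := M.charpoly_monic.ne_zero
  let P := (UniqueFactorizationMonoid.normalizedFactors M.charpoly).toFinset
  have hirr : ∀ φ ∈ P, Irreducible φ := fun φ hφ =>
    UniqueFactorizationMonoid.irreducible_of_normalized_factor φ (Multiset.mem_toFinset.1 hφ)
  have hdvd : ∀ φ ∈ P, φ ∣ M.charpoly := fun φ hφ =>
    UniqueFactorizationMonoid.dvd_of_mem_normalizedFactors (Multiset.mem_toFinset.1 hφ)
  have hcop : ∀ φ ∈ P, ∀ ψ ∈ P, φ ≠ ψ → IsCoprime φ ψ := by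
    intro φ hφ ψ hψ hne
    refine ((hirr φ hφ).coprime_iff_not_dvd).2 fun hd => hne ?_
    have := (hirr φ hφ).associated_of_dvd (hirr ψ hψ) hd
    have h1 := UniqueFactorizationMonoid.normalize_normalized_factor φ (Multiset.mem_toFinset.1 hφ)
    have h2 := UniqueFactorizationMonoid.normalize_normalized_factor ψ (Multiset.mem_toFinset.1 hψ)
    rw [← h1, ← h2]
    exact normalize_eq_normalize_iff_associated.2 this
  have hprod : Associated (∏ φ ∈ P, φ) M.charpoly := by
    have h1 := UniqueFactorizationMonoid.prod_normalizedFactors hM0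
    have h2 := (UniqueFactorizationMonoid.squarefree_iff_nodup_normalizedFactors hM0).1 h
    rwa [Finset.prod_eq_multiset_prod, Multiset.toFinset_val, h2.dedup, Multiset.map_id']
  choose! w hw0 hw using fun φ (hφ : φ ∈ P) => exists_aeval_mulVec_eq_zero (hirr φ hφ) (hdvd φ hφ)
  refine ⟨∑ φ ∈ P, w φ, fun p hp => ?_⟩
  refine hprod.symm.dvd.trans (Finset.prod_dvd_of_coprime
    (fun φ hφ ψ hψ hne => hcop φ hφ ψ hψ hne) fun φ hφ => ?_)
  by_contra hnd
  let g := ∏ ψ ∈ P.erase φ, ψ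
  have hcg : IsCoprime φ (p * g) := by
    refine IsCoprime.mul_right ((hirr φ hφ).coprime_iff_not_dvd.2 hnd)
      (IsCoprime.prod_right fun ψ hψ => ?_)
    exact hcop φ hφ ψ (Finset.mem_of_mem_erase hψ) (Finset.ne_of_mem_erase hψ).symm
  -- multiplying by `g` kills all the summands other than `w φ`
  have hgw : aeval M g *ᵥ (∑ ψ ∈ P, w ψ) = aeval M g *ᵥ w φ := by
    rw [← Finset.add_sum_erase P w hφ, mulVec_add, mulVec_sum, Finset.sum_eq_zero, add_zero]
    intro ψ hψ
    obtain ⟨c, hc⟩ : ψ ∣ g := Finset.dvd_prod_of_mem _ hψ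
    rw [hc, mul_comm, map_mul, ← mulVec_mulVec, hw ψ (Finset.mem_of_mem_erase hψ), mulVec_zero]
  have h0 : aeval M (p * g) *ᵥ w φ = 0 := by
    rw [map_mul, ← mulVec_mulVec, ← hgw, mulVec_mulVec, ← map_mul, mul_comm, map_mul,
      ← mulVec_mulVec, hp, mulVec_zero]
  obtain ⟨a, b, hab⟩ := hcg
  apply hw0 φ hφ
  have := congrArg (fun r => aeval M r *ᵥ w φ) hab
  rwa [map_add, add_mulVec, map_mul, map_mul _ b, ← mulVec_mulVec, ← mulVec_mulVec, hw φ hφ, h0,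
    mulVec_zero, mulVec_zero, add_zero, map_one, one_mulVec, eq_comm] at this

/-- If the characteristic polynomial `f` of `M` is squarefree, then `M` is, up to a linear change
of coordinates, multiplication by the class of `X` on `F[X]/(f)`. -/
theorem exists_adjoinRoot_equiv {f : F[X]} (hf : Squarefree f) {M : Matrix ι ι F}
    (hM : M.charpoly = f) :
    ∃ e : AdjoinRoot f ≃ₗ[F] (ι → F), ∀ x, e (AdjoinRoot.root f * x) = M *ᵥ e x := by
  subst hM
  obtain ⟨v, hv⟩ := exists_cyclic_vector hf
  have hm := M.charpoly_monic
  have hch : ∀ a ∈ Ideal.span {M.charpoly}, aeval M a = 0 := by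
    intro a ha
    obtain ⟨c, rfl⟩ := Ideal.mem_span_singleton.1 ha
    rw [map_mul, Matrix.aeval_self_charpoly, zero_mul]
  let ρ : AdjoinRoot M.charpoly →ₐ[F] Matrix ι ι F :=
    Ideal.Quotient.liftₐ (Ideal.span {M.charpoly}) (aeval M) hch
  have hρ : ∀ p, ρ (AdjoinRoot.mk _ p) = aeval M p := fun p => rfl
  let T : AdjoinRoot M.charpoly →ₗ[F] (ι → F) :=
    { toFun := fun x => ρ x *ᵥ v
      map_add' := fun x y => by rw [map_add, add_mulVec]
      map_smul' := fun c x => by rw [map_smul, smul_mulVec, RingHom.id_apply] }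
  have hT : Function.Injective T := by
    rw [← LinearMap.ker_eq_bot, LinearMap.ker_eq_bot']
    intro x hx
    obtain ⟨p, rfl⟩ := AdjoinRoot.mk_surjective x
    exact AdjoinRoot.mk_eq_zero.2 (hv p hx)
  have hfin : Module.Finite F (AdjoinRoot M.charpoly) := hm.finite_adjoinRoot
  have hrank : Module.finrank F (AdjoinRoot M.charpoly) = Module.finrank F (ι → F) := by
    rw [(AdjoinRoot.powerBasis hm.ne_zero).finrank, AdjoinRoot.powerBasis_dim,
      Matrix.charpoly_natDegree_eq_dim, Module.finrank_fintype_fun_eq_card]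
  refine ⟨LinearEquiv.ofInjectiveOfFinrankEq T hT hrank, fun x => ?_⟩
  change ρ (AdjoinRoot.root _ * x) *ᵥ v = M *ᵥ (ρ x *ᵥ v)
  have : ρ (AdjoinRoot.root M.charpoly) = M := by
    rw [← AdjoinRoot.mk_X, hρ, aeval_X]
  rw [map_mul, ← mulVec_mulVec, this]

theorem exists_conj_of_charpoly_eq {M N : Matrix ι ι F} (h : N.charpoly = M.charpoly)
    (hM : Squarefree M.charpoly) : ∃ P : GL ι F, (P : Matrix ι ι F) * M = N * P := by
  obtain ⟨e, he⟩ := exists_adjoinRoot_equiv hM rfl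
  obtain ⟨e', he'⟩ := exists_adjoinRoot_equiv hM h
  let E := e.symm.trans e'
  refine ⟨Matrix.GeneralLinearGroup.toLin.symm
    (LinearMap.GeneralLinearGroup.ofLinearEquiv E), ?_⟩
  have hE : ∀ x, LinearMap.toMatrix' E.toLinearMap *ᵥ x = E x := fun x => by
    rw [LinearMap.toMatrix'_mulVec]; rfl
  change LinearMap.toMatrix' E.toLinearMap * M = N * LinearMap.toMatrix' E.toLinearMap
  refine Matrix.ext_of_mulVec_single fun i => ?_
  rw [← mulVec_mulVec, ← mulVec_mulVec, hE, hE]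
  change e' (e.symm (M *ᵥ _)) = N *ᵥ e' (e.symm _)
  rw [← he', ← e.symm_apply_apply (AdjoinRoot.root _ * _), he, e.apply_symm_apply]

/-- As an `F[X]`-module, `F^ι` with `X` acting by `M` is isomorphic to a product of quotient rings
of `F[X]`, and the multiplications of that ring commute with `M`. -/
theorem card_le_finrank_centralizer (M : Matrix ι ι F) :
    Fintype.card ι ≤ Module.finrank F (Subalgebra.centralizer F {M}) := by
  classical
  let V := Module.AEval' (Matrix.toLin' M)
  obtain ⟨κ, _, p, -, k, ⟨e₀⟩⟩ := Module.equiv_directSum_of_isTorsion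
    (Module.AEval.isTorsion_of_finiteDimensional F (ι → F) (Matrix.toLin' M))
  let A := ∀ i, F[X] ⧸ Ideal.span {p i ^ k i}
  let e : V ≃ₗ[F[X]] A := e₀.trans (DirectSum.linearEquivFunOnFintype F[X] κ _)
  let o : (ι → F) ≃ₗ[F] V := Module.AEval'.of (Matrix.toLin' M)
  have hC : ∀ (c : F) (x : V), c • x = (C c : F[X]) • x := fun c x => by
    rw [Module.AEval.C_smul]
  -- the multiplication of the ring `A`, transported to `ι → F`
  let B : (ι → F) →ₗ[F] (ι → F) →ₗ[F] (ι → F) :=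
    LinearMap.mk₂ F (fun w v => o.symm (e.symm (e (o w) * e (o v))))
      (fun a b c => by simp only [map_add, add_mul])
      (fun c a b => by
        simp only [map_smul, hC, smul_mul_assoc]
        rw [← hC, map_smul])
      (fun a b c => by simp only [map_add, mul_add])
      (fun c a b => by
        simp only [map_smul, hC, mul_smul_comm]
        rw [← hC, map_smul])
  have hX : ∀ v, o (M *ᵥ v) = (X : F[X]) • o v := fun v => by
    rw [Module.AEval'.X_smul_of, Matrix.toLin'_apply]
  have hB : ∀ w v, B w (M *ᵥ v) = M *ᵥ B w v := by
    intro w v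
    apply o.injective
    rw [hX]
    simp only [B, LinearMap.mk₂_apply, LinearEquiv.apply_symm_apply, hX, map_smul, mul_smul_comm]
  let Φ : (ι → F) →ₗ[F] Subalgebra.toSubmodule (Subalgebra.centralizer F {M}) :=
    LinearMap.codRestrict _ (LinearMap.toMatrix'.toLinearMap ∘ₗ B) (by
      intro w
      refine (Subalgebra.mem_centralizer_iff F).2 ?_
      rintro _ rfl
      refine Matrix.ext_of_mulVec_single fun i => ?_
      simp only [LinearMap.comp_apply, LinearEquiv.coe_coe, ← mulVec_mulVec,
        LinearMap.toMatrix'_mulVec, hB])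
  have hΦ : Function.Injective Φ := by
    rw [← LinearMap.ker_eq_bot, LinearMap.ker_eq_bot']
    intro w hw
    have h1 : B w = 0 := by
      have := congrArg Subtype.val hw
      exact LinearMap.toMatrix'.map_eq_zero_iff.1 this
    have h2 := LinearMap.congr_fun h1 (o.symm (e.symm 1))
    simpa [B] using h2
  have := LinearMap.finrank_le_finrank_of_injective hΦ
  rwa [Module.finrank_fintype_fun_eq_card] at this

theorem finrank_centralizer_le_of_conj {M N : Matrix ι ι F} (P : GL ι F)
    (h : (P : Matrix ι ι F) * M = N * P) :
    Module.finrank F (Subalgebra.centralizer F {M}) ≤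
      Module.finrank F (Subalgebra.centralizer F {N}) := by
  let Φ : Matrix ι ι F →ₗ[F] Matrix ι ι F :=
    LinearMap.mulLeft F (P : Matrix ι ι F) ∘ₗ
      LinearMap.mulRight F ((P⁻¹ : GL ι F) : Matrix ι ι F)
  have hN : ((P⁻¹ : GL ι F) : Matrix ι ι F) * N = M * ((P⁻¹ : GL ι F) : Matrix ι ι F) := by
    rw [Units.inv_mul_eq_iff_eq_mul, ← mul_assoc, h, mul_assoc, Units.mul_inv, mul_one]
  have hΦ : ∀ x ∈ Subalgebra.toSubmodule (Subalgebra.centralizer F {M}),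
      Φ x ∈ Subalgebra.toSubmodule (Subalgebra.centralizer F {N}) := by
    intro x hx
    have hx' : M * x = x * M := (Subalgebra.mem_centralizer_iff F).1 hx M rfl
    refine (Subalgebra.mem_centralizer_iff F).2 ?_
    rintro _ rfl
    change _ * ((P : Matrix ι ι F) * (x * _)) = (P : Matrix ι ι F) * (x * _) * _
    rw [← mul_assoc, ← h, mul_assoc, mul_assoc, mul_assoc, hN, ← mul_assoc M, hx', mul_assoc]
  refine LinearMap.finrank_le_finrank_of_injective (f := Φ.restrict hΦ) ?_
  rw [← LinearMap.ker_eq_bot, LinearMap.ker_eq_bot']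
  intro x hx
  have h1 : (P : Matrix ι ι F) * (x * ((P⁻¹ : GL ι F) : Matrix ι ι F)) = 0 :=
    congrArg Subtype.val hx
  apply Subtype.ext
  rwa [Units.mul_right_eq_zero, Units.mul_left_eq_zero] at h1

/-- A matrix commutes with `diagonal d` if and only if its entry at `(i, j)` vanishes whenever
`d i ≠ d j`. -/
theorem finrank_centralizer_diagonal [DecidableEq F] (d : ι → F) :
    Module.finrank F (Subalgebra.centralizer F {diagonal d}) =
      Fintype.card {p : ι × ι // d p.1 = d p.2} := by
  have hmem : ∀ x : Matrix ι ι F, x ∈ Subalgebra.centralizer F {diagonal d} ↔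
      ∀ i j, d i * x i j = x i j * d j := by
    intro x
    rw [Subalgebra.mem_centralizer_iff]
    simp only [Set.mem_singleton_iff, forall_eq]
    simp only [← Matrix.ext_iff, diagonal_mul, mul_diagonal]
  let E : Subalgebra.toSubmodule (Subalgebra.centralizer F {diagonal d}) ≃ₗ[F]
      ({p : ι × ι // d p.1 = d p.2} → F) :=
    { toFun := fun x p => (x : Matrix ι ι F) p.1.1 p.1.2
      map_add' := fun x y => rfl
      map_smul' := fun c x => rfl
      invFun := fun y => ⟨Matrix.of fun i j => if h : d i = d j then y ⟨(i, j), h⟩ else 0, by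
        refine (hmem _).2 fun i j => ?_
        by_cases h : d i = d j
        · simp [h, mul_comm]
        · simp [h]⟩
      left_inv := fun x => by
        ext i j
        by_cases h : d i = d j
        · simp [h]
        · have := (hmem x).1 x.2 i j
          rw [mul_comm] at this
          have h0 : (x : Matrix ι ι F) i j = 0 := by
            by_contra hne
            exact h (mul_left_cancel₀ hne this)
          simp [h, h0]
      right_inv := fun y => by
        ext ⟨⟨i, j⟩, h⟩
        have h' : d i = d j := h
        simp [h'] }
  have := E.finrank_eq
  rwa [Module.finrank_fintype_fun_eq_card] at this

theorem card_le_iff_injective {ι F : Type*} [Fintype ι] [DecidableEq F] (d : ι → F) :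
    Fintype.card {p : ι × ι // d p.1 = d p.2} ≤ Fintype.card ι ↔ Function.Injective d := by
  let δ : ι → {p : ι × ι // d p.1 = d p.2} := fun i => ⟨(i, i), rfl⟩
  have hδ : Function.Injective δ := fun i j h => congrArg (fun p => p.1.1) h
  constructor
  · intro h i j hij
    have hb : Function.Bijective δ := (Fintype.bijective_iff_injective_and_card δ).2
      ⟨hδ, le_antisymm (Fintype.card_le_of_injective δ hδ) h⟩
    obtain ⟨a, ha⟩ := hb.2 ⟨(i, j), hij⟩
    have h1 : (a, a) = (i, j) := congrArg Subtype.val ha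
    rw [Prod.mk.injEq] at h1
    exact h1.1.symm.trans h1.2
  · intro h
    refine Fintype.card_le_of_injective (fun p => p.1.1) ?_
    rintro ⟨⟨i, j⟩, hij⟩ ⟨⟨i', j'⟩, hij'⟩ (rfl : i = i')
    have h1 := h hij
    have h2 := h hij'
    simp_all

end Linear

/-! ### The criterion for regular semisimplicity -/

section Criterion

open Polynomial Matrix

variable {n : ℕ} {F : Type*} [Field F]

theorem coe_toClosure (α : GL (Fin n) F) :
    (toClosure α : Matrix (Fin n) (Fin n) (AlgebraicClosure F)) =
      (α : Matrix (Fin n) (Fin n) F).map (algebraMap F (AlgebraicClosure F)) := rfl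

theorem finrank_centralizer_le_of_isRegular {α : GL (Fin n) F} (h : IsRegular α) :
    Module.finrank (AlgebraicClosure F) (Subalgebra.centralizer (AlgebraicClosure F)
      {(toClosure α : Matrix (Fin n) (Fin n) (AlgebraicClosure F))}) ≤ n := by
  classical
  have : Infinite {x : AlgebraicClosure F // x ≠ 0} :=
    (Set.finite_singleton (0 : AlgebraicClosure F)).infinite_compl.to_subtype
  let d₀ := Infinite.natEmbedding {x : AlgebraicClosure F // x ≠ 0}
  -- the comparison element: a diagonal matrix with distinct nonzero entries
  let d : Fin n → AlgebraicClosure F := fun i => d₀ i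
  have hd : Function.Injective d := fun i j hij =>
    Fin.ext (d₀.injective (Subtype.ext hij))
  have hdet : (diagonal d).det ≠ 0 := by
    rw [det_diagonal]
    exact Finset.prod_ne_zero_iff.2 fun i _ => (d₀ i).2
  have h1 := h (Matrix.GeneralLinearGroup.mkOfDetNeZero (diagonal d) hdet)
  rw [centralizerDim_eq_finrank, centralizerDim_eq_finrank] at h1
  have h2 := (finrank_centralizer_diagonal d).trans_le ((card_le_iff_injective d).2 hd)
  rw [Fintype.card_fin] at h2
  refine le_trans ?_ h2
  exact_mod_cast h1

theorem squarefree_of_isRegularSemisimple {α : GL (Fin n) F} (h : IsRegularSemisimple α) :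
    Squarefree (α : Matrix (Fin n) (Fin n) F).charpoly := by
  classical
  obtain ⟨hreg, P, hP⟩ := h
  obtain ⟨d, hd⟩ : ∃ d, diagonal d =
      ((P * toClosure α * P⁻¹ : GL (Fin n) (AlgebraicClosure F)) :
        Matrix (Fin n) (Fin n) (AlgebraicClosure F)) := ⟨_, hP.diagonal_diag⟩
  have hconj : ((P⁻¹ : GL (Fin n) (AlgebraicClosure F)) : Matrix (Fin n) (Fin n) _) * diagonal d =
      (toClosure α : Matrix (Fin n) (Fin n) (AlgebraicClosure F)) *
        ((P⁻¹ : GL (Fin n) (AlgebraicClosure F)) : Matrix (Fin n) (Fin n) _) := by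
    rw [hd, ← Units.val_mul, ← Units.val_mul]
    congr 1
    group
  have h1 := (finrank_centralizer_le_of_conj P⁻¹ hconj).trans
    (finrank_centralizer_le_of_isRegular hreg)
  rw [finrank_centralizer_diagonal] at h1
  have hinj : Function.Injective d := (card_le_iff_injective d).1 (by simpa using h1)
  have hchar : (toClosure α : Matrix (Fin n) (Fin n) (AlgebraicClosure F)).charpoly =
      ∏ i, (X - C (d i)) := by
    rw [← Matrix.charpoly_diagonal, hd, Units.val_mul, Units.val_mul, Matrix.coe_units_inv,
      Matrix.charpoly_units_conj]
  rw [coe_toClosure, Matrix.charpoly_map] at hchar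
  have hsep : ((α : Matrix (Fin n) (Fin n) F).charpoly.map
      (algebraMap F (AlgebraicClosure F))).Separable := by
    rw [hchar]
    exact Polynomial.separable_prod_X_sub_C_iff.2 hinj
  exact ((Polynomial.separable_map _).1 hsep).squarefree

theorem isRegularSemisimple_of_squarefree [PerfectField F] {α : GL (Fin n) F}
    (h : Squarefree (α : Matrix (Fin n) (Fin n) F).charpoly) : IsRegularSemisimple α := by
  classical
  set M := (toClosure α : Matrix (Fin n) (Fin n) (AlgebraicClosure F)) with hM
  have hsep : M.charpoly.Separable := by
    rw [hM, coe_toClosure, Matrix.charpoly_map]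
    exact (PerfectField.separable_iff_squarefree.2 h).map
  have hsplit : M.charpoly.Splits := IsAlgClosed.splits _
  have hnodup : M.charpoly.roots.Nodup := nodup_roots hsep
  have hcard : M.charpoly.roots.toFinset.card = n := by
    rw [Multiset.toFinset_card_of_nodup hnodup, ← hsplit.natDegree_eq_card_roots,
      Matrix.charpoly_natDegree_eq_dim, Fintype.card_fin]
  let E := M.charpoly.roots.toFinset.equivFinOfCardEq hcard
  let d : Fin n → AlgebraicClosure F := fun i => E.symm i
  have hd : Function.Injective d := Subtype.val_injective.comp E.symm.injective
  have hchar : (diagonal d).charpoly = M.charpoly := by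
    rw [Matrix.charpoly_diagonal, hsplit.eq_prod_roots_of_monic M.charpoly_monic]
    rw [Equiv.prod_comp E.symm fun x : M.charpoly.roots.toFinset => (X - C (x : AlgebraicClosure F)),
      Finset.prod_coe_sort M.charpoly.roots.toFinset fun x => X - C x,
      Finset.prod_eq_multiset_prod, Multiset.toFinset_val, hnodup.dedup]
  obtain ⟨P, hP⟩ := exists_conj_of_charpoly_eq hchar hsep.squarefree
  refine ⟨fun g => ?_, P, ?_⟩
  · rw [centralizerDim_eq_finrank, centralizerDim_eq_finrank]
    have h1 := (finrank_centralizer_le_of_conj P hP).trans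
      ((finrank_centralizer_diagonal d).trans_le ((card_le_iff_injective d).2 hd))
    exact_mod_cast h1.trans (card_le_finrank_centralizer _)
  · have : ((P * toClosure α * P⁻¹ : GL (Fin n) (AlgebraicClosure F)) :
        Matrix (Fin n) (Fin n) (AlgebraicClosure F)) = diagonal d := by
      rw [Units.val_mul, Units.val_mul, ← hM, hP, Units.mul_inv_cancel_right]
    rw [this]
    exact isDiag_diagonal d

theorem isRegularSemisimple_iff_squarefree [PerfectField F] {α : GL (Fin n) F} :
    IsRegularSemisimple α ↔ Squarefree (α : Matrix (Fin n) (Fin n) F).charpoly :=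
  ⟨squarefree_of_isRegularSemisimple, isRegularSemisimple_of_squarefree⟩

theorem squarefree_iff_partitionSize_le_one {α : GL (Fin n) F} :
    Squarefree (α : Matrix (Fin n) (Fin n) F).charpoly ↔
      ∀ φ : F[X], φ.Monic → Irreducible φ → partitionSize α φ ≤ 1 := by
  classical
  constructor
  · intro h φ _ hφ
    exact ((squarefree_iff_emultiplicity_le_one _).1 h φ).resolve_right hφ.not_isUnit
  · intro h
    rw [squarefree_iff_irreducible_sq_not_dvd_of_ne_zero (Matrix.charpoly_monic _).ne_zero]
    intro φ hφ hdvd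
    have hirr : Irreducible (normalize φ) := (normalize_associated φ).symm.irreducible hφ
    have h1 := h (normalize φ) (Polynomial.monic_normalize hφ.ne_zero) hirr
    have h2 : normalize φ ^ 2 ∣ (α : Matrix (Fin n) (Fin n) F).charpoly := by
      rw [pow_two]
      exact ((normalize_associated φ).mul_mul (normalize_associated φ)).dvd.trans hdvd
    have h3 := (le_emultiplicity_of_pow_dvd h2).trans h1
    norm_num at h3

end Criterion

/-! ### Counting matrices with a given squarefree characteristic polynomial -/

section Counting

open Polynomial Matrix

variable {F : Type*} [Field F]

/-- A linear isomorphism `e : F[X]/(f) ≃ Fⁿ` transports multiplication by the class of `X` to a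
matrix with characteristic polynomial `f`. All `e` giving the same matrix differ by multiplication
by a unit of `F[X]/(f)`. -/
theorem card_charpoly_eq_mul_card_units {n : ℕ} {f : F[X]} (hmonic : f.Monic)
    (hf : Squarefree f) (hn : f.natDegree = n) :
    Nat.card {M : Matrix (Fin n) (Fin n) F // M.charpoly = f} * Nat.card (AdjoinRoot f)ˣ =
      Nat.card (GL (Fin n) F) := by
  classical
  have hfin : Module.Finite F (AdjoinRoot f) := hmonic.finite_adjoinRoot
  have hrank : Module.finrank F (AdjoinRoot f) = Module.finrank F (Fin n → F) := by
    rw [(AdjoinRoot.powerBasis hmonic.ne_zero).finrank, AdjoinRoot.powerBasis_dim,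
      Module.finrank_fin_fun, hn]
  have hGL : Nat.card (AdjoinRoot f ≃ₗ[F] (Fin n → F)) = Nat.card (GL (Fin n) F) := by
    let e₀ := LinearEquiv.ofFinrankEq _ _ hrank
    refine Nat.card_congr (Equiv.trans
      ⟨fun e => e₀.symm.trans e, fun e => e₀.trans e, fun e => ?_, fun e => ?_⟩
      (Matrix.GeneralLinearGroup.toLin.trans
        (LinearMap.GeneralLinearGroup.generalLinearEquiv F (Fin n → F))).symm.toEquiv)
    · ext x; simp
    · ext x; simp
  rw [← hGL, ← Nat.card_prod]
  choose E hE using fun M : {M : Matrix (Fin n) (Fin n) F // M.charpoly = f} =>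
    exists_adjoinRoot_equiv hf M.2
  -- `(M, u)` is sent to the isomorphism `E M` chosen for `M`, preceded by multiplication by `u`
  let Ψ : {M : Matrix (Fin n) (Fin n) F // M.charpoly = f} × (AdjoinRoot f)ˣ →
      (AdjoinRoot f ≃ₗ[F] (Fin n → F)) := fun p =>
    (LinearEquiv.smulOfUnit p.2).restrictScalars F |>.trans (E p.1)
  have hΨ : ∀ p x, Ψ p x = E p.1 (p.2 * x) := fun p x => rfl
  refine Nat.card_congr (Equiv.ofBijective Ψ ⟨?_, ?_⟩)
  · rintro ⟨M, u⟩ ⟨N, w⟩ h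
    have hM : ∀ x, Ψ (M, u) (AdjoinRoot.root f * x) = M.1 *ᵥ Ψ (M, u) x := fun x => by
      rw [hΨ, hΨ, ← hE, mul_left_comm]
    have hN : ∀ x, Ψ (N, w) (AdjoinRoot.root f * x) = N.1 *ᵥ Ψ (N, w) x := fun x => by
      rw [hΨ, hΨ, ← hE, mul_left_comm]
    have hMN : M = N := by
      refine Subtype.ext (Matrix.ext_of_mulVec_single fun i => ?_)
      rw [← (Ψ (M, u)).apply_symm_apply (Pi.single i 1), ← hM, h, hN]
    subst hMN
    have h1 := LinearEquiv.congr_fun h 1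
    rw [hΨ, hΨ, mul_one, mul_one] at h1
    exact Prod.ext rfl (Units.ext ((E M).injective h1))
  · intro e
    let R : AdjoinRoot f →ₗ[F] AdjoinRoot f := LinearMap.mulLeft F (AdjoinRoot.root f)
    let M : Matrix (Fin n) (Fin n) F := LinearMap.toMatrix' (e.conj R)
    have hMe : ∀ x, e (AdjoinRoot.root f * x) = M *ᵥ e x := fun x => by
      rw [LinearMap.toMatrix'_mulVec, LinearEquiv.conj_apply_apply, e.symm_apply_apply]
      rfl
    have hM : M.charpoly = f := by
      have h1 := charpoly_leftMulMatrix (AdjoinRoot.powerBasis' hmonic)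
      rw [Algebra.leftMulMatrix_apply, LinearMap.charpoly_toMatrix, AdjoinRoot.powerBasis'_gen,
        AdjoinRoot.minpoly_root hmonic.ne_zero, hmonic.leadingCoeff, inv_one, C_1, mul_one] at h1
      have h2 : M.charpoly = (e.conj R).charpoly :=
        LinearMap.charpoly_toMatrix (e.conj R) (Pi.basisFun F (Fin n))
      rw [h2, LinearEquiv.charpoly_conj]
      exact h1
    -- `T` commutes with multiplication by the class of `X`, so it is multiplication by `T 1`
    let T : AdjoinRoot f → AdjoinRoot f := fun x => (E ⟨M, hM⟩).symm (e x)
    have hTroot : ∀ x, T (AdjoinRoot.root f * x) = AdjoinRoot.root f * T x := fun x => by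
      apply (E ⟨M, hM⟩).injective
      rw [hE]
      simp only [T, LinearEquiv.apply_symm_apply, hMe]
    have hT : ∀ x, T x = x * T 1 := by
      intro x
      obtain ⟨p, rfl⟩ := AdjoinRoot.mk_surjective x
      induction p using Polynomial.induction_on' with
      | add p q hp hq =>
        have : T (AdjoinRoot.mk f p + AdjoinRoot.mk f q) =
            T (AdjoinRoot.mk f p) + T (AdjoinRoot.mk f q) := by
          simp only [T, map_add]
        rw [map_add, this, hp, hq, add_mul]
      | monomial k c =>
        have hk : ∀ k : ℕ, T (AdjoinRoot.root f ^ k) = AdjoinRoot.root f ^ k * T 1 := by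
          intro k
          induction k with
          | zero => simp
          | succ k ih => rw [pow_succ', hTroot, ih, mul_assoc]
        have hc : ∀ x : AdjoinRoot f, T (c • x) = c • T x := fun x => by
          simp only [T, map_smul]
        have : AdjoinRoot.mk f (monomial k c) = c • AdjoinRoot.root f ^ k := by
          rw [← smul_X_eq_monomial, ← AdjoinRoot.smul_mk, map_pow, AdjoinRoot.mk_X]
        rw [this, hc, hk, smul_mul_assoc]
    obtain ⟨y, hy⟩ : ∃ y, T y = 1 := ⟨e.symm (E ⟨M, hM⟩ 1), by simp [T]⟩
    rw [hT] at hy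
    refine ⟨(⟨M, hM⟩, Units.mkOfMulEqOne _ _ ((mul_comm _ _).trans hy)), ?_⟩
    ext1 x
    have : T 1 * x = T x := by rw [mul_comm, ← hT]
    rw [hΨ, Units.val_mkOfMulEqOne, this]
    exact (E ⟨M, hM⟩).apply_symm_apply _

variable (F) in
/-- The monic irreducible polynomials over `F`. -/
abbrev MonicIrreducible := {φ : F[X] // φ.Monic ∧ Irreducible φ}

theorem MonicIrreducible.eq_of_dvd {φ ψ : MonicIrreducible F} (h : φ.1 ∣ ψ.1) : φ = ψ :=
  Subtype.ext (eq_of_monic_of_associated φ.2.1 ψ.2.1 (φ.2.2.associated_of_dvd ψ.2.2 h))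

theorem MonicIrreducible.isCoprime {φ ψ : MonicIrreducible F} (h : φ ≠ ψ) :
    IsCoprime φ.1 ψ.1 :=
  φ.2.2.coprime_iff_not_dvd.2 fun hd => h (MonicIrreducible.eq_of_dvd hd)

theorem MonicIrreducible.dvd_prod_iff {φ : MonicIrreducible F}
    {s : Finset (MonicIrreducible F)} : φ.1 ∣ ∏ ψ ∈ s, ψ.1 ↔ φ ∈ s := by
  rw [φ.2.2.prime.dvd_finsetProd_iff]
  refine ⟨fun ⟨ψ, hψ, h⟩ => ?_, fun h => ⟨φ, h, dvd_rfl⟩⟩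
  rwa [MonicIrreducible.eq_of_dvd h]

theorem MonicIrreducible.prod_injective :
    Function.Injective fun s : Finset (MonicIrreducible F) => ∏ φ ∈ s, φ.1 := by
  intro s t h
  ext φ
  rw [← MonicIrreducible.dvd_prod_iff, ← MonicIrreducible.dvd_prod_iff]
  exact iff_of_eq (congrArg (φ.1 ∣ ·) h)

theorem MonicIrreducible.monic_prod (s : Finset (MonicIrreducible F)) :
    (∏ φ ∈ s, φ.1).Monic := monic_prod_of_monic _ _ fun φ _ => φ.2.1

theorem MonicIrreducible.squarefree_prod (s : Finset (MonicIrreducible F)) :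
    Squarefree (∏ φ ∈ s, φ.1) :=
  Finset.squarefree_prod_of_pairwise_isCoprime
    (fun _ _ _ _ h => (MonicIrreducible.isCoprime h).isRelPrime) fun φ _ => φ.2.2.squarefree

theorem MonicIrreducible.natDegree_prod (s : Finset (MonicIrreducible F)) :
    (∏ φ ∈ s, φ.1).natDegree = ∑ φ ∈ s, φ.1.natDegree :=
  natDegree_prod_of_monic _ _ fun φ _ => φ.2.1

theorem MonicIrreducible.exists_prod_eq {f : F[X]} (hmonic : f.Monic) (hf : Squarefree f) :
    ∃ s : Finset (MonicIrreducible F), ∏ φ ∈ s, φ.1 = f := by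
  classical
  have h0 := hmonic.ne_zero
  have hmem : ∀ φ ∈ (UniqueFactorizationMonoid.normalizedFactors f).toFinset,
      φ.Monic ∧ Irreducible φ := by
    intro φ hφ
    rw [Multiset.mem_toFinset] at hφ
    have hirr := UniqueFactorizationMonoid.irreducible_of_normalized_factor φ hφ
    refine ⟨?_, hirr⟩
    rw [← UniqueFactorizationMonoid.normalize_normalized_factor φ hφ]
    exact Polynomial.monic_normalize hirr.ne_zero
  refine ⟨(UniqueFactorizationMonoid.normalizedFactors f).toFinset.subtype _,
    eq_of_monic_of_associated (MonicIrreducible.monic_prod _) hmonic ?_⟩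
  rw [Finset.prod_subtype_of_mem (fun φ => φ) hmem]
  have h1 := UniqueFactorizationMonoid.prod_normalizedFactors h0
  have h2 := (UniqueFactorizationMonoid.squarefree_iff_nodup_normalizedFactors h0).1 hf
  rwa [Finset.prod_eq_multiset_prod, Multiset.toFinset_val, h2.dedup, Multiset.map_id']

/-- By the Chinese remainder theorem, the units of `F[X]/(∏ φ)` are the tuples of nonzero elements
of the fields `F[X]/(φ)`. -/
theorem card_units_adjoinRoot [Finite F] (s : Finset (MonicIrreducible F)) :
    Nat.card (AdjoinRoot (∏ φ ∈ s, φ.1))ˣ = ∏ φ ∈ s, (Nat.card F ^ φ.1.natDegree - 1) := by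
  classical
  let I : s → Ideal F[X] := fun φ => Ideal.span {φ.1.1}
  have hI : Pairwise (Function.onFun IsCoprime I) := fun φ ψ h => by
    rw [Function.onFun, Ideal.isCoprime_span_singleton_iff]
    exact MonicIrreducible.isCoprime fun h' => h (Subtype.ext h')
  have hinf : Ideal.span {∏ φ ∈ s, φ.1} = ⨅ φ, I φ := by
    rw [Ideal.iInf_span_singleton, Finset.prod_coe_sort s fun φ => φ.1]
    intro φ ψ h
    exact MonicIrreducible.isCoprime fun h' => h (Subtype.ext h')
  let E : AdjoinRoot (∏ φ ∈ s, φ.1) ≃+* ∀ φ, F[X] ⧸ I φ :=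
    (Ideal.quotEquivOfEq hinf).trans (Ideal.quotientInfRingEquivPiQuotient I hI)
  have hcard : ∀ φ : s, Nat.card (F[X] ⧸ I φ)ˣ = Nat.card F ^ φ.1.1.natDegree - 1 := by
    intro φ
    have := Fact.mk φ.1.2.2
    change Nat.card (AdjoinRoot φ.1.1)ˣ = _
    have hfin : Module.Finite F (AdjoinRoot φ.1.1) := φ.1.2.1.finite_adjoinRoot
    rw [Nat.card_units, Module.natCard_eq_pow_finrank (K := F),
      (AdjoinRoot.powerBasis φ.1.2.1.ne_zero).finrank, AdjoinRoot.powerBasis_dim]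
  rw [Nat.card_congr ((Units.mapEquiv E.toMulEquiv).trans MulEquiv.piUnits).toEquiv, Nat.card_pi]
  simp only [hcard]
  exact Finset.prod_coe_sort s fun φ => Nat.card F ^ φ.1.natDegree - 1

end Counting

/-! ### The proportion of regular semisimple elements -/

section Probability

open Polynomial Matrix

variable {F : Type*} [Field F]

/-- The factor contributed by `φ` to the proportion of the elements of `GL(n, F)` whose
characteristic polynomial is a given squarefree multiple of `φ`. The polynomial `X` contributes `0`,
as it does not divide the characteristic polynomial of an invertible matrix. -/
noncomputable def weight (φ : MonicIrreducible F) : ℝ :=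
  open Classical in if φ.1 = X then 0 else ((Nat.card F : ℝ) ^ φ.1.natDegree - 1)⁻¹

theorem card_GL_charpoly_eq [Finite F] (s : Finset (MonicIrreducible F)) {n : ℕ}
    (hn : ∑ φ ∈ s, φ.1.natDegree = n) :
    (Nat.card {α : GL (Fin n) F // (α : Matrix (Fin n) (Fin n) F).charpoly = ∏ φ ∈ s, φ.1} : ℝ) =
      Nat.card (GL (Fin n) F) * ∏ φ ∈ s, weight φ := by
  classical
  have hq : 1 < Nat.card F := Finite.one_lt_card
  have hX : ∀ α : GL (Fin n) F, ¬ X ∣ (α : Matrix (Fin n) (Fin n) F).charpoly := by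
    intro α h
    rw [X_dvd_iff] at h
    have hdet := Matrix.det_eq_sign_charpoly_coeff (α : Matrix (Fin n) (Fin n) F)
    rw [h, mul_zero] at hdet
    exact ((Matrix.isUnit_iff_isUnit_det _).1 α.isUnit).ne_zero hdet
  by_cases hs : ∃ φ ∈ s, φ.1 = X
  · obtain ⟨φ, hφ, h⟩ := hs
    have hw : weight φ = 0 := if_pos h
    rw [Finset.prod_eq_zero (f := weight) hφ hw, mul_zero, Nat.cast_eq_zero]
    have : IsEmpty {α : GL (Fin n) F //
        (α : Matrix (Fin n) (Fin n) F).charpoly = ∏ φ ∈ s, φ.1} := by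
      refine ⟨fun α => hX α.1 ?_⟩
      rw [α.2, ← h]
      exact MonicIrreducible.dvd_prod_iff.2 hφ
    exact Nat.card_of_isEmpty
  · push Not at hs
    have hcoeff : (∏ φ ∈ s, φ.1).coeff 0 ≠ 0 := by
      rw [ne_eq, ← X_dvd_iff, prime_X.dvd_finsetProd_iff]
      rintro ⟨φ, hφ, h⟩
      exact hs φ hφ (congrArg Subtype.val (MonicIrreducible.eq_of_dvd
        (φ := ⟨X, monic_X, irreducible_X⟩) h)).symm
    have hcard : Nat.card {α : GL (Fin n) F //
        (α : Matrix (Fin n) (Fin n) F).charpoly = ∏ φ ∈ s, φ.1} =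
        Nat.card {M : Matrix (Fin n) (Fin n) F // M.charpoly = ∏ φ ∈ s, φ.1} := by
      refine Nat.card_congr (Equiv.ofBijective (fun α => ⟨α.1, α.2⟩) ⟨fun α β h => ?_, fun M => ?_⟩)
      · exact Subtype.ext (Units.ext (congrArg Subtype.val h))
      · have hdet : M.1.det ≠ 0 := by
          rw [Matrix.det_eq_sign_charpoly_coeff, M.2]
          exact mul_ne_zero (pow_ne_zero _ (neg_ne_zero.2 one_ne_zero)) hcoeff
        exact ⟨⟨Matrix.GeneralLinearGroup.mkOfDetNeZero M.1 hdet, M.2⟩, rfl⟩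
    have hmul := card_charpoly_eq_mul_card_units (MonicIrreducible.monic_prod s)
      (MonicIrreducible.squarefree_prod s) ((MonicIrreducible.natDegree_prod s).trans hn)
    rw [← hcard, card_units_adjoinRoot] at hmul
    have hpos : ∀ φ ∈ s, ((Nat.card F : ℝ) ^ φ.1.natDegree - 1) ≠ 0 := fun φ _ =>
      sub_ne_zero.2 (one_lt_pow₀ (by exact_mod_cast hq) φ.2.2.natDegree_pos.ne').ne'
    have hw : ∏ φ ∈ s, weight φ = (∏ φ ∈ s, ((Nat.card F : ℝ) ^ φ.1.natDegree - 1))⁻¹ := by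
      rw [← Finset.prod_inv_distrib]
      exact Finset.prod_congr rfl fun φ hφ => if_neg (hs φ hφ)
    rw [hw, ← hmul, Nat.cast_mul, Nat.cast_prod]
    have hsub : ∀ φ ∈ s, ((Nat.card F ^ φ.1.natDegree - 1 : ℕ) : ℝ) =
        (Nat.card F : ℝ) ^ φ.1.natDegree - 1 := fun φ _ => by
      rw [Nat.cast_sub (Nat.one_le_pow _ _ (by omega)), Nat.cast_pow, Nat.cast_one]
    rw [Finset.prod_congr rfl hsub, mul_assoc, mul_inv_cancel₀ (Finset.prod_ne_zero_iff.2 hpos),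
      mul_one]

theorem card_monic_natDegree_eq (F : Type*) [Field F] (n : ℕ) :
    Nat.card {p : F[X] // p.Monic ∧ p.natDegree = n} = Nat.card F ^ n := by
  rw [Nat.card_congr (monicEquivDegreeLT n),
    Nat.card_congr (Polynomial.degreeLTEquiv F n).toEquiv, Nat.card_fun, Nat.card_fin]

instance [Finite F] (n : ℕ) : Finite {p : F[X] // p.Monic ∧ p.natDegree = n} :=
  Finite.of_equiv _ ((monicEquivDegreeLT n).trans
    (Polynomial.degreeLTEquiv F n).toEquiv).symm

instance [Finite F] (n : ℕ) :
    Finite {s : Finset (MonicIrreducible F) // ∑ φ ∈ s, φ.1.natDegree = n} :=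
  Finite.of_injective (β := {p : F[X] // p.Monic ∧ p.natDegree = n})
    (fun s => ⟨∏ φ ∈ s.1, φ.1, MonicIrreducible.monic_prod _,
      (MonicIrreducible.natDegree_prod _).trans s.2⟩)
    fun _ _ h => Subtype.ext (MonicIrreducible.prod_injective (Subtype.mk.inj h))

theorem probRegularSemisimple_eq_tsum [Finite F] (n : ℕ) :
    probRegularSemisimple F n =
      ∑' s : {s : Finset (MonicIrreducible F) // ∑ φ ∈ s, φ.1.natDegree = n},
        ∏ φ ∈ s.1, weight φ := by
  classical
  have := Fintype.ofFinite {s : Finset (MonicIrreducible F) // ∑ φ ∈ s, φ.1.natDegree = n}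
  let S := Σ s : {s : Finset (MonicIrreducible F) // ∑ φ ∈ s, φ.1.natDegree = n},
    {α : GL (Fin n) F // (α : Matrix (Fin n) (Fin n) F).charpoly = ∏ φ ∈ s.1, φ.1}
  let Φ : S → {α : GL (Fin n) F // IsRegularSemisimple α} := fun x =>
    ⟨x.2.1, isRegularSemisimple_iff_squarefree.2 (by
      rw [x.2.2]; exact MonicIrreducible.squarefree_prod _)⟩
  have hΦ : Function.Bijective Φ := by
    constructor
    · rintro ⟨⟨s, hs⟩, ⟨α, hα⟩⟩ ⟨⟨t, ht⟩, ⟨β, hβ⟩⟩ h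
      obtain rfl : α = β := Subtype.mk.inj h
      obtain rfl : s = t := MonicIrreducible.prod_injective (hα.symm.trans hβ)
      rfl
    · rintro ⟨α, hα⟩
      obtain ⟨s, hs⟩ := MonicIrreducible.exists_prod_eq (Matrix.charpoly_monic _)
        (isRegularSemisimple_iff_squarefree.1 hα)
      refine ⟨⟨⟨s, ?_⟩, ⟨α, hs.symm⟩⟩, rfl⟩
      rw [← MonicIrreducible.natDegree_prod, hs, Matrix.charpoly_natDegree_eq_dim, Fintype.card_fin]
  have hG : (Nat.card (GL (Fin n) F) : ℝ) ≠ 0 := Nat.cast_ne_zero.2 Nat.card_pos.ne'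
  rw [probRegularSemisimple, ← Nat.card_congr (Equiv.ofBijective Φ hΦ), Nat.card_sigma,
    tsum_fintype, div_eq_iff hG, Nat.cast_sum, Finset.sum_mul]
  refine Finset.sum_congr rfl fun s _ => ?_
  rw [card_GL_charpoly_eq s.1 s.2, mul_comm]

end Probability

/-! ### The zeta function of `F[X]` -/

section Zeta

open Polynomial

variable {F : Type*} [Field F]

theorem MonicIrreducible.exists_mem_iff_dvd {f : F[X]} (hf : f.Monic) :
    ∃ P : Finset (MonicIrreducible F), ∀ φ, φ ∈ P ↔ φ.1 ∣ f := by
  classical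
  refine ⟨(UniqueFactorizationMonoid.normalizedFactors f).toFinset.subtype _, fun φ => ?_⟩
  rw [Finset.mem_subtype, Multiset.mem_toFinset,
    UniqueFactorizationMonoid.mem_normalizedFactors_iff' hf.ne_zero]
  exact ⟨fun h => h.2.2, fun h => ⟨φ.2.2, φ.2.1.normalize_eq_self, h⟩⟩

theorem MonicIrreducible.exists_dvd {f : F[X]} (hf : f.Monic) (h1 : f ≠ 1) :
    ∃ φ : MonicIrreducible F, φ.1 ∣ f := by
  classical
  obtain ⟨φ, hφ, hdvd⟩ := WfDvdMonoid.exists_irreducible_factor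
    (fun h => h1 (hf.eq_one_of_isUnit h)) hf.ne_zero
  have hn := normalize_associated φ
  exact ⟨⟨normalize φ, Polynomial.monic_normalize hφ.ne_zero, hn.symm.irreducible hφ⟩,
    hn.dvd.trans hdvd⟩

theorem card_monic_fiber (n : ℕ) :
    Nat.card {f : {f : F[X] // f.Monic} // f.1.natDegree = n} = Nat.card F ^ n := by
  rw [← card_monic_natDegree_eq F n]
  exact Nat.card_congr (Equiv.subtypeSubtypeEquivSubtypeInter _ fun f : F[X] => f.natDegree = n)

variable [Finite F]

instance (n : ℕ) : Finite {f : {f : F[X] // f.Monic} // f.1.natDegree = n} :=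
  Nat.finite_of_card_ne_zero (by
    rw [card_monic_fiber]
    exact pow_ne_zero _ Nat.card_pos.ne')

theorem summable_pow_natDegree_monic {x : ℝ} (h0 : 0 ≤ x) (hx : Nat.card F * x < 1) :
    Summable fun f : {f : F[X] // f.Monic} => x ^ f.1.natDegree := by
  rw [← (Equiv.sigmaFiberEquiv fun f : {f : F[X] // f.Monic} => f.1.natDegree).summable_iff]
  refine (summable_sigma_of_nonneg fun _ => ?_).2 ⟨fun n => Summable.of_finite, ?_⟩
  · exact pow_nonneg h0 _
  have : ∀ n : ℕ, ∑' f : {f : {f : F[X] // f.Monic} // f.1.natDegree = n},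
      x ^ f.1.1.natDegree = (Nat.card F * x) ^ n := by
    intro n
    rw [tsum_congr fun f => by rw [f.2], tsum_const, card_monic_fiber, nsmul_eq_mul, mul_pow,
      Nat.cast_pow]
  exact (summable_geometric_of_lt_one (by positivity) hx).congr fun n => (this n).symm

theorem summable_pow_natDegree {x : ℝ} (h0 : 0 ≤ x) (hx : Nat.card F * x < 1) :
    Summable fun φ : MonicIrreducible F => x ^ φ.1.natDegree :=
  (summable_pow_natDegree_monic h0 hx).comp_injective
    (i := fun φ : MonicIrreducible F => (⟨φ.1, φ.2.1⟩ : {f : F[X] // f.Monic}))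
    fun _ _ h => Subtype.ext (congrArg (fun f : {f : F[X] // f.Monic} => f.1) h)

theorem tsum_pow_natDegree_monic {x : ℂ} (hx : Nat.card F * ‖x‖ < 1) :
    ∑' f : {f : F[X] // f.Monic}, x ^ f.1.natDegree = (1 - Nat.card F * x)⁻¹ := by
  have hs : Summable fun f : {f : F[X] // f.Monic} => x ^ f.1.natDegree :=
    .of_norm (by simpa using summable_pow_natDegree_monic (norm_nonneg x) hx)
  have h1 := ((Equiv.sigmaFiberEquiv
    fun f : {f : F[X] // f.Monic} => f.1.natDegree).hasSum_iff.2 hs.hasSum).sigma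
    fun n => Summable.hasSum Summable.of_finite
  have h2 : ∀ n : ℕ, ∑' f : {f : {f : F[X] // f.Monic} // f.1.natDegree = n},
      x ^ f.1.1.natDegree = (Nat.card F * x) ^ n := by
    intro n
    rw [tsum_congr fun f => by rw [f.2], tsum_const, card_monic_fiber, nsmul_eq_mul, mul_pow,
      Nat.cast_pow]
  refine h1.unique ((hasSum_geometric_of_norm_lt_one ?_).congr_fun fun n => h2 n)
  rwa [norm_mul, Complex.norm_natCast]

/-- The Euler product of the zeta function `∑ x ^ deg f = 1 / (1 - q x)` of `F[X]`. The product is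
expanded as a sum over finite sets `s` of monic irreducible polynomials, and in its product with the
zeta function the terms with a given value of `f = g * ∏ s` cancel, since the sum of `(-1) ^ #s`
over all sets `s` of irreducible factors of `f` vanishes for `f ≠ 1`. -/
theorem tprod_one_sub_pow_natDegree {x : ℂ} (hx : Nat.card F * ‖x‖ < 1) :
    ∏' φ : MonicIrreducible F, (1 - x ^ φ.1.natDegree) = 1 - Nat.card F * x := by
  classical
  have hsφ : Summable fun φ : MonicIrreducible F => ‖-x ^ φ.1.natDegree‖ := by
    simpa using summable_pow_natDegree (norm_nonneg x) hx
  have hsf : Summable fun f : {f : F[X] // f.Monic} => ‖x ^ f.1.natDegree‖ := by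
    simpa using summable_pow_natDegree_monic (norm_nonneg x) hx
  have hss : Summable fun s : Finset (MonicIrreducible F) => ‖∏ φ ∈ s, -x ^ φ.1.natDegree‖ := by
    simp_rw [norm_prod]
    exact summable_finsetProd_of_summable_nonneg (fun _ => norm_nonneg _) hsφ
  simp_rw [sub_eq_add_neg (1 : ℂ)]
  rw [tprod_one_add hss.of_norm]
  choose P hP using fun f : {f : F[X] // f.Monic} => MonicIrreducible.exists_mem_iff_dvd f.2
  have hdiv : ∀ (f : {f : F[X] // f.Monic}) (s : (P f).powerset),
      ∃ g : {f : F[X] // f.Monic}, g.1 * ∏ φ ∈ s.1, φ.1 = f.1 := by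
    intro f s
    obtain ⟨g, hg⟩ : ∏ φ ∈ s.1, φ.1 ∣ f.1 :=
      Finset.prod_dvd_of_coprime (fun φ _ ψ _ h => MonicIrreducible.isCoprime h)
        fun φ hφ => (hP f φ).1 (Finset.mem_powerset.1 s.2 hφ)
    have hm := f.2
    rw [hg] at hm
    exact ⟨⟨g, (MonicIrreducible.monic_prod _).of_mul_monic_left hm⟩, by rw [mul_comm, hg]⟩
  choose g hg using hdiv
  -- the pairs `(g, s)` are grouped by the value of `g * ∏ φ ∈ s, φ`
  let Ψ : (Σ f, ((P f).powerset : Finset (Finset (MonicIrreducible F)))) →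
      {f : F[X] // f.Monic} × Finset (MonicIrreducible F) := fun p => (g p.1 p.2, p.2.1)
  have hΨ : Function.Bijective Ψ := by
    constructor
    · rintro ⟨f, ⟨s, hs⟩⟩ ⟨f', ⟨s', hs'⟩⟩ h
      obtain ⟨h1, h2⟩ := Prod.mk.inj h
      change s = s' at h2
      subst h2
      have : f = f' := by
        apply Subtype.ext
        rw [← hg f ⟨s, hs⟩, ← hg f' ⟨s, hs'⟩, h1]
      subst this
      rfl
    · rintro ⟨g', s⟩
      have hs : s ∈ (P ⟨g'.1 * ∏ φ ∈ s, φ.1, g'.2.mul (MonicIrreducible.monic_prod s)⟩).powerset :=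
        Finset.mem_powerset.2 fun φ hφ => (hP _ φ).2
          (dvd_mul_of_dvd_right (Finset.dvd_prod_of_mem _ hφ) _)
      refine ⟨⟨_, ⟨s, hs⟩⟩, Prod.ext (Subtype.ext ?_) rfl⟩
      exact mul_right_cancel₀ (MonicIrreducible.monic_prod s).ne_zero (hg _ ⟨s, hs⟩)
  have h1 := ((Equiv.ofBijective Ψ hΨ).hasSum_iff.2
    (summable_mul_of_summable_norm hsf hss).hasSum).sigma
    fun f => Summable.hasSum Summable.of_finite
  rw [← tsum_mul_tsum_of_summable_norm hsf hss, tsum_pow_natDegree_monic hx] at h1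
  have h2 : ∀ f : {f : F[X] // f.Monic}, f ≠ ⟨1, monic_one⟩ →
      ∑' s : (P f).powerset, x ^ (g f s).1.natDegree * ∏ φ ∈ s.1, -x ^ φ.1.natDegree = 0 := by
    intro f hf
    have h3 : ∀ s : (P f).powerset,
        x ^ (g f s).1.natDegree * ∏ φ ∈ s.1, -x ^ φ.1.natDegree =
          x ^ f.1.natDegree * (((-1) ^ s.1.card : ℤ) : ℂ) := by
      intro s
      rw [← hg f s, (g f s).2.natDegree_mul (MonicIrreducible.monic_prod _),
        MonicIrreducible.natDegree_prod, pow_add, ← Finset.prod_pow_eq_pow_sum, Finset.prod_neg]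
      push_cast
      ring
    obtain ⟨φ, hφ⟩ := MonicIrreducible.exists_dvd f.2 fun h => hf (Subtype.ext h)
    rw [tsum_congr h3, tsum_fintype, ← Finset.mul_sum,
      Finset.sum_coe_sort (P f).powerset fun s => (((-1) ^ s.card : ℤ) : ℂ), ← Int.cast_sum,
      Finset.sum_powerset_neg_one_pow_card_of_nonempty ⟨φ, (hP f φ).2 hφ⟩, Int.cast_zero, mul_zero]
  have hP1 : P ⟨1, monic_one⟩ = ∅ := by
    refine Finset.eq_empty_of_forall_notMem fun φ hφ => ?_
    exact φ.2.2.not_isUnit (isUnit_of_dvd_one ((hP _ φ).1 hφ))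
  have h4 : ∑' s : (P ⟨1, monic_one⟩).powerset,
      x ^ (g ⟨1, monic_one⟩ s).1.natDegree * ∏ φ ∈ s.1, -x ^ φ.1.natDegree = 1 := by
    have hs : ∀ s : (P ⟨1, monic_one⟩).powerset, s.1 = ∅ := fun s =>
      Finset.subset_empty.1 ((Finset.mem_powerset.1 s.2).trans hP1.subset)
    have huniq : Unique (P ⟨1, monic_one⟩).powerset :=
      ⟨⟨⟨∅, Finset.empty_mem_powerset _⟩⟩, fun s => Subtype.ext (hs s)⟩
    rw [tsum_eq_single default fun s h => (h (huniq.uniq s)).elim]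
    have h5 := hg ⟨1, monic_one⟩ default
    rw [hs, Finset.prod_empty, mul_one] at h5
    rw [hs, h5]
    simp
  have h6 := h1.unique (hasSum_single ⟨1, monic_one⟩ h2)
  have hne : 1 - (Nat.card F : ℂ) * x ≠ 0 := by
    intro h
    have := congrArg norm (sub_eq_zero.1 h)
    rw [norm_one, norm_mul, Complex.norm_natCast] at this
    exact hx.ne this.symm
  have h7 := h6.trans h4
  rwa [inv_mul_eq_one₀ hne, eq_comm] at h7

end Zeta

/-! ### Coefficients of a power series with a simple pole at one -/

/-- If `∑ aₙ uⁿ = G(u) / (1 - u)` on the unit disc and `G` is holomorphic on a larger disc, then the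
`aₙ` are the partial sums of the Taylor coefficients of `G`, and so they tend to `G(1)`. -/
theorem tendsto_coeff_of_hasSum_div_one_sub {a : ℕ → ℂ} {A G : ℂ → ℂ} {R : ℝ} (hR : 1 < R)
    (hG : DifferentiableOn ℂ G (Metric.ball 0 R))
    (hA : ∀ u : ℂ, ‖u‖ < 1 → HasSum (fun n => a n * u ^ n) (A u))
    (hAG : ∀ u : ℂ, ‖u‖ < 1 → A u * (1 - u) = G u) :
    Tendsto a atTop (𝓝 (G 1)) := by
  -- the Taylor coefficients of `G`
  let c : ℕ → ℂ := fun n => (n.factorial : ℂ)⁻¹ * iteratedDeriv n G 0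
  have hc : ∀ u : ℂ, ‖u‖ < R → HasSum (fun n => c n * u ^ n) (G u) := by
    intro u hu
    have := Complex.hasSum_taylorSeries_on_ball hG (mem_ball_zero_iff.2 hu)
    simp only [sub_zero, smul_eq_mul] at this
    refine this.congr_fun fun n => ?_
    simp only [c]
    ring
  have hC : ∀ u : ℂ, ‖u‖ < 1 →
      HasSum (fun n => (∑ k ∈ Finset.range (n + 1), c k) * u ^ n) (A u) := by
    intro u hu
    have h1 := hc u (hu.trans hR)
    have h2 := hasSum_sum_range_mul_of_summable_norm h1.summable.norm
      (summable_geometric_of_norm_lt_one hu).norm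
    have hne : 1 - u ≠ 0 := by
      intro h
      rw [← sub_eq_zero.1 h, norm_one] at hu
      exact lt_irrefl _ hu
    rw [h1.tsum_eq, tsum_geometric_of_norm_lt_one hu, ← hAG u hu, mul_inv_cancel_right₀ hne] at h2
    refine h2.congr_fun fun n => ?_
    rw [Finset.sum_mul]
    refine Finset.sum_congr rfl fun k hk => ?_
    rw [mul_assoc (c k), ← pow_add, Nat.add_sub_cancel' (Nat.lt_succ_iff.1 (Finset.mem_range.1 hk))]
  have hps : ∀ b : ℕ → ℂ, (∀ u : ℂ, ‖u‖ < 1 → HasSum (fun n => b n * u ^ n) (A u)) →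
      HasFPowerSeriesAt A (FormalMultilinearSeries.ofScalars ℂ b) 0 := by
    intro b hb
    rw [hasFPowerSeriesAt_iff]
    filter_upwards [Metric.ball_mem_nhds (0 : ℂ) one_pos] with u hu
    rw [zero_add]
    refine (hb u (mem_ball_zero_iff.1 hu)).congr_fun fun n => ?_
    rw [FormalMultilinearSeries.coeff_ofScalars, smul_eq_mul, mul_comm]
  have heq := (hps _ hA).eq_formalMultilinearSeries (hps _ hC)
  have ha : ∀ n, a n = ∑ k ∈ Finset.range (n + 1), c k := by
    intro n
    have := congrArg (fun p => p.coeff n) heq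
    simpa [FormalMultilinearSeries.coeff_ofScalars] using this
  have h1 := (hc 1 (by rwa [norm_one])).tendsto_sum_nat
  simp only [one_pow, mul_one] at h1
  exact ((tendsto_add_atTop_iff_nat 1).2 h1).congr fun n => (ha n).symm

/-! ### The limit -/

section Limit

open Polynomial

variable {F : Type*} [Field F]

theorem weight_X : weight (⟨X, monic_X, irreducible_X⟩ : MonicIrreducible F) = 0 := if_pos rfl

/-- The local factor at `φ` of `(1 - u) * ∑ₙ probRegularSemisimple F n * u ^ n`, minus one. -/
noncomputable def localFactor (φ : MonicIrreducible F) (u : ℂ) : ℂ :=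
  (1 + (weight φ : ℂ) * u ^ φ.1.natDegree) *
    (1 - ((Nat.card F : ℂ)⁻¹ * u) ^ φ.1.natDegree) - 1

theorem localFactor_X (u : ℂ) :
    localFactor (⟨X, monic_X, irreducible_X⟩ : MonicIrreducible F) u = -((Nat.card F : ℂ)⁻¹ * u) := by
  simp [localFactor, weight_X]

variable [Finite F]

theorem weight_nonneg (φ : MonicIrreducible F) : 0 ≤ weight φ := by
  have hq : (1 : ℝ) < Nat.card F := by exact_mod_cast Finite.one_lt_card
  unfold weight
  split_ifs
  · exact le_rfl
  · exact inv_nonneg.2 (sub_nonneg.2 (one_le_pow₀ hq.le))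

theorem weight_le (φ : MonicIrreducible F) :
    weight φ ≤ 2 * ((Nat.card F : ℝ)⁻¹) ^ φ.1.natDegree := by
  have hq : (2 : ℝ) ≤ Nat.card F := by exact_mod_cast Finite.one_lt_card (α := F)
  have hQ : (2 : ℝ) ≤ (Nat.card F : ℝ) ^ φ.1.natDegree :=
    hq.trans (le_self_pow₀ (by linarith) φ.2.2.natDegree_pos.ne')
  unfold weight
  split_ifs
  · positivity
  · rw [inv_pow, ← div_eq_mul_inv, inv_eq_one_div, div_le_div_iff₀ (by linarith) (by linarith)]
    linarith

theorem summable_weight_mul_pow {u : ℂ} (hu : ‖u‖ < 1) :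
    Summable fun φ : MonicIrreducible F => ‖(weight φ : ℂ) * u ^ φ.1.natDegree‖ := by
  have hq : (0 : ℝ) < Nat.card F := by exact_mod_cast Nat.card_pos
  have h := summable_pow_natDegree (F := F) (x := (Nat.card F : ℝ)⁻¹ * ‖u‖) (by positivity)
    (by rwa [mul_inv_cancel_left₀ hq.ne'])
  refine Summable.of_nonneg_of_le (fun _ => norm_nonneg _) (fun φ => ?_) (h.mul_left 2)
  rw [norm_mul, norm_pow, Complex.norm_real, Real.norm_of_nonneg (weight_nonneg φ), mul_pow,
    ← mul_assoc]
  exact mul_le_mul_of_nonneg_right (weight_le φ) (by positivity)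

theorem hasSum_probRegularSemisimple_mul_pow {u : ℂ} (hu : ‖u‖ < 1) :
    HasSum (fun n => (probRegularSemisimple F n : ℂ) * u ^ n)
      (∏' φ : MonicIrreducible F, (1 + (weight φ : ℂ) * u ^ φ.1.natDegree)) := by
  have hs := summable_finsetProd_of_summable_norm (summable_weight_mul_pow (F := F) hu)
  rw [tprod_one_add hs]
  have h := ((Equiv.sigmaFiberEquiv
    fun s : Finset (MonicIrreducible F) => ∑ φ ∈ s, φ.1.natDegree).hasSum_iff.2 hs.hasSum).sigma
    fun n => Summable.hasSum Summable.of_finite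
  refine h.congr_fun fun n => ?_
  rw [probRegularSemisimple_eq_tsum, Complex.ofReal_tsum, ← tsum_mul_right]
  refine tsum_congr fun s => ?_
  change _ = ∏ φ ∈ s.1, _
  rw [Finset.prod_mul_distrib, Finset.prod_pow_eq_pow_sum, s.2, Complex.ofReal_prod]

/-- Away from `φ = X` the terms of order `u ^ deg φ / q ^ deg φ` cancel. This makes the product of
the local factors converge beyond the unit disc, with each of them equal to one at `u = 1`. -/
theorem localFactor_of_ne_X {φ : MonicIrreducible F} (hφ : φ.1 ≠ X) (u : ℂ) :
    localFactor φ u = weight φ * ((Nat.card F : ℂ)⁻¹) ^ φ.1.natDegree *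
      (u ^ φ.1.natDegree * (1 - u ^ φ.1.natDegree)) := by
  have hq : (1 : ℝ) < Nat.card F := by exact_mod_cast Finite.one_lt_card
  have hQ : (1 : ℝ) < (Nat.card F : ℝ) ^ φ.1.natDegree := one_lt_pow₀ hq φ.2.2.natDegree_pos.ne'
  have hw : weight φ = ((Nat.card F : ℝ) ^ φ.1.natDegree - 1)⁻¹ := if_neg hφ
  have h0 : ((Nat.card F : ℂ) ^ φ.1.natDegree) ≠ 0 := by exact_mod_cast (zero_lt_one.trans hQ).ne'
  have h1 : ((Nat.card F : ℂ) ^ φ.1.natDegree - 1) ≠ 0 := by exact_mod_cast (sub_pos.2 hQ).ne'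
  rw [localFactor, hw, mul_pow, inv_pow]
  push_cast
  field_simp
  ring

theorem norm_localFactor_le {φ : MonicIrreducible F} (hφ : φ.1 ≠ X) {u : ℂ} {R : ℝ} (hR : 1 ≤ R)
    (hu : ‖u‖ ≤ R) :
    ‖localFactor φ u‖ ≤ 4 * (((Nat.card F : ℝ)⁻¹ * R) ^ 2) ^ φ.1.natDegree := by
  set m := φ.1.natDegree
  have h1 : ‖u‖ ^ m ≤ R ^ m := pow_le_pow_left₀ (norm_nonneg _) hu m
  have h2 : (1 : ℝ) ≤ R ^ m := one_le_pow₀ hR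
  have h3 : ‖1 - u ^ m‖ ≤ 2 * R ^ m := by
    refine (norm_sub_le _ _).trans ?_
    rw [norm_one, norm_pow]
    linarith
  rw [localFactor_of_ne_X hφ, norm_mul, norm_mul, norm_mul, norm_pow, norm_pow, norm_inv,
    Complex.norm_natCast, Complex.norm_real, Real.norm_of_nonneg (weight_nonneg φ)]
  calc weight φ * (Nat.card F : ℝ)⁻¹ ^ m * (‖u‖ ^ m * ‖1 - u ^ m‖)
      ≤ (2 * (Nat.card F : ℝ)⁻¹ ^ m) * (Nat.card F : ℝ)⁻¹ ^ m * (R ^ m * (2 * R ^ m)) := by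
        gcongr
        exact weight_le φ
    _ = 4 * (((Nat.card F : ℝ)⁻¹ * R) ^ 2) ^ m := by ring

theorem differentiableOn_tprod_localFactor :
    DifferentiableOn ℂ (fun u => ∏' φ : MonicIrreducible F, (1 + localFactor φ u))
      (Metric.ball 0 (6 / 5)) := by
  have hq : (2 : ℝ) ≤ Nat.card F := by exact_mod_cast Finite.one_lt_card (α := F)
  -- `6 / 5` may be any number greater than one whose square is less than `q`
  have hsum := (summable_pow_natDegree (F := F) (x := ((Nat.card F : ℝ)⁻¹ * (6 / 5)) ^ 2)
    (by positivity) (by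
      rw [mul_pow, inv_pow, ← mul_assoc, pow_two, mul_inv, mul_inv_cancel_left₀ (by linarith),
        inv_mul_lt_iff₀ (by linarith)]
      linarith)).mul_left 4
  have hdiff : ∀ φ : MonicIrreducible F, Differentiable ℂ (localFactor φ) := fun φ => by
    unfold localFactor
    fun_prop
  refine (Summable.hasProdLocallyUniformlyOn_one_add Metric.isOpen_ball hsum ?_
    fun φ => (hdiff φ).continuous.continuousOn).differentiableOn (.of_forall fun s => ?_)
    Metric.isOpen_ball
  · refine (Set.finite_singleton (⟨X, monic_X, irreducible_X⟩ : MonicIrreducible F)).subset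
      fun φ hφ => ?_
    by_contra hne
    exact hφ fun u hu => norm_localFactor_le (fun h => hne (Subtype.ext h)) (by norm_num)
      (mem_ball_zero_iff.1 hu).le
  · refine DifferentiableOn.fun_finsetProd fun φ _ => ?_
    exact ((hdiff φ).const_add 1).differentiableOn

theorem tprod_localFactor_one :
    ∏' φ : MonicIrreducible F, (1 + localFactor φ 1) = 1 - (Nat.card F : ℂ)⁻¹ := by
  rw [tprod_eq_mulSingle (⟨X, monic_X, irreducible_X⟩ : MonicIrreducible F), localFactor_X, mul_one,
    sub_eq_add_neg]
  intro φ hφ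
  rw [localFactor_of_ne_X fun h => hφ (Subtype.ext h)]
  simp

theorem tprod_weight_mul_one_sub {u : ℂ} (hu : ‖u‖ < 1) :
    (∏' φ : MonicIrreducible F, (1 + (weight φ : ℂ) * u ^ φ.1.natDegree)) * (1 - u) =
      ∏' φ : MonicIrreducible F, (1 + localFactor φ u) := by
  have hq : (0 : ℝ) < Nat.card F := by exact_mod_cast Nat.card_pos
  have hq' : (Nat.card F : ℂ) ≠ 0 := by exact_mod_cast hq.ne'
  have hx : Nat.card F * ‖(Nat.card F : ℂ)⁻¹ * u‖ < 1 := by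
    rwa [norm_mul, norm_inv, Complex.norm_natCast, mul_inv_cancel_left₀ hq.ne']
  have h1 := tprod_one_sub_pow_natDegree (F := F) hx
  rw [mul_inv_cancel_left₀ hq'] at h1
  have h2 : Multipliable fun φ : MonicIrreducible F =>
      1 - ((Nat.card F : ℂ)⁻¹ * u) ^ φ.1.natDegree := by
    simp_rw [sub_eq_add_neg (1 : ℂ)]
    refine multipliable_one_add_of_summable ?_
    simpa using summable_pow_natDegree (F := F) (norm_nonneg ((Nat.card F : ℂ)⁻¹ * u)) hx
  rw [← h1, ← (multipliable_one_add_of_summable (summable_weight_mul_pow hu)).tprod_mul h2]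
  exact tprod_congr fun φ => by rw [localFactor, add_sub_cancel]

theorem tendsto_probRegularSemisimple :
    Tendsto (fun n : ℕ => probRegularSemisimple F n) atTop (𝓝 (1 - 1 / (Nat.card F : ℝ))) := by
  have h := tendsto_coeff_of_hasSum_div_one_sub (by norm_num)
    (differentiableOn_tprod_localFactor (F := F))
    (fun u hu => hasSum_probRegularSemisimple_mul_pow hu)
    (fun u hu => tprod_weight_mul_one_sub hu)
  rw [tprod_localFactor_one] at h
  rw [← tendsto_ofReal_iff]
  simpa using h

end Limit

end GLRegSS

theorem mainTheorem7 (F : Type*) [Field F] [Finite F] :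
    (∀ (n : ℕ) (α : GL (Fin n) F), GLRegSS.IsRegularSemisimple α ↔
      ∀ φ : Polynomial F, φ.Monic → Irreducible φ → GLRegSS.partitionSize α φ ≤ 1) ∧
    Tendsto (fun n : ℕ => GLRegSS.probRegularSemisimple F n) atTop
      (𝓝 (1 - 1 / (Nat.card F : ℝ))) :=
  ⟨fun _ _ => GLRegSS.isRegularSemisimple_iff_squarefree.trans
    GLRegSS.squarefree_iff_partitionSize_le_one, GLRegSS.tendsto_probRegularSemisimple⟩
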